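/- Let $n\ge 1$ and let $(M,\omega)$ be a pre-$n$-plectic manifold, i.e. a smooth manifold $M$ with a closed form $\omega\in\Omega^{n+1}(M)$. Write $\iota$ for the interior product and $\mathcal L_v=d\iota_v+\iota_v d$ for the Lie derivative. A vector field $v_\alpha$ is a Hamiltonian vector field of $\alpha\in\Omega^{n-1}(M)$ if $d\alpha=-\iota_{v_\alpha}\omega$, and $\alpha$ is Hamiltonian if it has a Hamiltonian vector field. Let $\mathfrak g$ be a real Lie algebra and $\partial_k\colon\Lambda^k\mathfrak g\to\Lambda^{k-1}\mathfrak g$ the linear map with $$\partial_k(x_1\wedge\dots\wedge x_k)=\sum_{1\le i<j\le k}(-1)^{i+j}[x_i,x_j]\wedge x_1\wedge\dots\wedge\hat x_i\wedge\dots\wedge\hat x_j\wedge\dots\wedge x_k ,$$ and let $B_k(\mathfrak g)=\operatorname{im}(\partial_{k+1})\subset\Lambda^k\mathfrak g$. Let $\mathfrak g\to\mathfrak X(M)$, $x\mapsto v_x$, be a Lie algebra homomorphism with $\mathcal L_{v_x}\omega=0$ for all $x\in\mathfrak g$. For $p=x_1\wedge\dots\wedge x_k$ put $\iota(v_p)=\iota_{v_{x_k}}\cdots\iota_{v_{x_1}}$,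 extended linearly to $p\in\Lambda^k\mathfrak g$, and let $\varsigma(k)=-(-1)^{k(k+1)/2}$. Let $(f)$ be a homotopy co-momentum map for this action: linear maps $f_k\colon\Lambda^k\mathfrak g\to\Omega^{n-k}(M)$, $1\le k\le n$, such that every $f_1(x)$ is Hamiltonian, $d f_1(x)=-\iota_{v_x}\omega$ for all $x\in\mathfrak g$, and, with $f_0=0$ and $f_{n+1}=0$, $$-f_{k-1}(\partial_k p)=d f_k(p)+\varsigma(k)\,\iota(v_p)\omega\qquad\text{for all }1\le k\le n+1,\ p\in\Lambda^k\mathfrak g .$$ Let $H\in\Omega^{n-1}(M)$ be a Hamiltonian form, and suppose that the action is locally $H$-preserving, i.e. $\mathcal L_{v_x}H$ is closed for all $x\in\mathfrak g$. Then for every $1\le k\le n$, every $p\in B_k(\mathfrak g)$ and every Hamiltonian vector field $v_H$ of $H$, the form $f_k(p)$ is globally conserved by $v_H$, i.e. $\mathcal L_{v_H}f_k(p)$ is exact (where an exact $0$-form means the zero function). -/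

import Mathlib

open scoped Manifold ContDiff

noncomputable section

namespace Multisymplectic

section Contraction

variable {V : Type*} [NormedAddCommGroup V] [NormedSpace ℝ V] {l : ℕ}

/-- The iterated contraction `ι_{u_k} ⋯ ι_{u_1} α` of an alternating form `α` with vectors `u_i`. -/
def iterContract :
    {k : ℕ} → (V [⋀^Fin (l + k)]→L[ℝ] ℝ) → (Fin k → V) → V [⋀^Fin l]→L[ℝ] ℝ
  | 0, α, _ => α
  | _ + 1, α, u => iterContract (α.curryLeft (u 0)) (Fin.tail u)

theorem iterContract_apply {k : ℕ} (α : V [⋀^Fin (l + k)]→L[ℝ] ℝ) (u : Fin k → V)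
    (w : Fin l → V) :
    iterContract α u w = α (fun i ↦ Fin.append u w (Fin.cast (Nat.add_comm l k) i)) := by
  induction k with
  | zero =>
    simp only [iterContract]
    congr 1
    ext i
    have : Fin.cast (Nat.add_comm l 0) i = Fin.natAdd 0 i := by ext; simp
    rw [this, Fin.append_right]
  | succ k ih =>
    simp only [iterContract]
    rw [ih, ContinuousAlternatingMap.curryLeft_apply_apply]
    refine congrArg α ?_
    funext i
    refine Fin.cases ?_ (fun i ↦ ?_) i
    · have : Fin.cast (Nat.add_comm l (k + 1)) (0 : Fin (l + k + 1)) = Fin.castAdd l 0 := by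
        ext; simp
      rw [this, Fin.append_left]
      rfl
    · rw [Matrix.cons_val_succ]
      rcases lt_or_ge (i : ℕ) k with h | h
      · have h1 : Fin.cast (Nat.add_comm l k) i = Fin.castAdd l ⟨i, h⟩ := by ext; simp
        have h2 : Fin.cast (Nat.add_comm l (k + 1)) i.succ =
            Fin.castAdd l (⟨i + 1, by omega⟩ : Fin (k + 1)) := by ext; simp
        rw [h1, h2, Fin.append_left, Fin.append_left]
        rfl
      · have hi : (i : ℕ) < l + k := i.2
        have h1 : Fin.cast (Nat.add_comm l k) i =
            Fin.natAdd k (⟨i - k, by omega⟩ : Fin l) := by ext; simp; omega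
        have h2 : Fin.cast (Nat.add_comm l (k + 1)) i.succ =
            Fin.natAdd (k + 1) (⟨i - k, by omega⟩ : Fin l) := by ext; simp; omega
        rw [h1, h2, Fin.append_right, Fin.append_right]

theorem append_update_cast {V : Type*} {k l : ℕ} (u : Fin k → V) (w : Fin l → V) (i : Fin k) (a : V) :
    (fun j : Fin (l + k) ↦
      Fin.append (Function.update u i a) w (Fin.cast (Nat.add_comm l k) j)) =
    Function.update (fun j ↦ Fin.append u w (Fin.cast (Nat.add_comm l k) j))
      (Fin.cast (Nat.add_comm k l) (Fin.castAdd l i)) a := by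
  funext j
  obtain ⟨j, rfl⟩ : ∃ j', Fin.cast (Nat.add_comm k l) j' = j :=
    ⟨Fin.cast (Nat.add_comm l k) j, by simp⟩
  simp only [Fin.cast_cast, Fin.cast_eq_self, Function.update_apply, Fin.cast_inj]
  refine Fin.addCases (fun j ↦ ?_) (fun j ↦ ?_) j
  · simp [Function.update_apply]
  · have : Fin.natAdd k j ≠ Fin.castAdd l i := by
      intro h
      have := congrArg Fin.val h
      simp at this
      omega
    simp [this]

/-- The iterated contraction is alternating in the vectors. -/
def contractAlt {k : ℕ} (α : V [⋀^Fin (l + k)]→L[ℝ] ℝ) :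
    V [⋀^Fin k]→ₗ[ℝ] (V [⋀^Fin l]→L[ℝ] ℝ) where
  toFun u := iterContract α u
  map_update_add' u i a b := by
    obtain rfl := Subsingleton.elim ‹DecidableEq (Fin k)› (instDecidableEqFin k)
    ext w
    simp only [iterContract_apply, append_update_cast, ContinuousAlternatingMap.add_apply,
      ContinuousAlternatingMap.map_update_add]
  map_update_smul' u i c a := by
    obtain rfl := Subsingleton.elim ‹DecidableEq (Fin k)› (instDecidableEqFin k)
    ext w
    simp only [iterContract_apply, append_update_cast, ContinuousAlternatingMap.smul_apply,
      ContinuousAlternatingMap.map_update_smul]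
  map_eq_zero_of_eq' u i j h hij := by
    ext w
    rw [iterContract_apply]
    refine α.map_eq_zero_of_eq _ (i := Fin.cast (Nat.add_comm k l) (Fin.castAdd l i))
      (j := Fin.cast (Nat.add_comm k l) (Fin.castAdd l j)) ?_ ?_
    · simpa using h
    · simpa using hij

/-- The contraction `ι(P) α` with a multivector `P ∈ Λ^k V`; on `P = u_1 ∧ ⋯ ∧ u_k` it is
`ι_{u_k} ⋯ ι_{u_1} α`. -/
def contract {k : ℕ} (α : V [⋀^Fin (l + k)]→L[ℝ] ℝ) :
    ⋀[ℝ]^k V →ₗ[ℝ] (V [⋀^Fin l]→L[ℝ] ℝ) :=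
  exteriorPower.alternatingMapLinearEquiv (contractAlt α)

end Contraction

section Homology

variable (𝔤 : Type*) [LieRing 𝔤] [LieAlgebra ℝ 𝔤]

/-- The trilinear expression `[x, y] ∧ z_1 ∧ ⋯ ∧ z_k`. -/
def bracketWedge (k : ℕ) : 𝔤 →ₗ[ℝ] 𝔤 →ₗ[ℝ] 𝔤 [⋀^Fin k]→ₗ[ℝ] ⋀[ℝ]^(k + 1) 𝔤 :=
  (LieModule.toEnd ℝ 𝔤 𝔤 : 𝔤 →ₗ[ℝ] 𝔤 →ₗ[ℝ] 𝔤).compr₂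
    (exteriorPower.ιMulti ℝ (k + 1) (M := 𝔤)).curryLeft

/-- The right-hand side of the formula defining the Lie algebra homology differential on
`x_0 ∧ ⋯ ∧ x_{k+1}`:
`∑_{a < b} (-1)^{a+b} [x_a, x_b] ∧ x_0 ∧ ⋯ x̂_a ⋯ x̂_b ⋯ ∧ x_{k+1}`.
Pairs `a < b` are written as `a = i.castSucc`, `b = j.succ` with `i ≤ j`. Numbering from `0` instead of
`1` does not change the sign. -/
def lieBoundaryFormula (k : ℕ) (x : Fin (k + 2) → 𝔤) : ⋀[ℝ]^(k + 1) 𝔤 :=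
  ∑ i : Fin (k + 1), ∑ j ≥ i,
    (-1 : ℝ) ^ ((i.castSucc : ℕ) + (j.succ : ℕ)) •
      exteriorPower.ιMulti ℝ (k + 1)
        (Matrix.vecCons ⁅x i.castSucc, x j.succ⁆ (j.removeNth (i.castSucc.removeNth x)))

theorem lieBoundaryFormula_eq (k : ℕ) (x : Fin (k + 2) → 𝔤) :
    lieBoundaryFormula 𝔤 k x = (-(1 / 2 : ℝ)) • AlternatingMap.alternatizeUncurryFin
      (AlternatingMap.alternatizeUncurryFinLM ∘ₗ bracketWedge 𝔤 k) x := by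
  rw [AlternatingMap.alternatizeUncurryFin_alternatizeUncurryFinLM_comp_apply, Finset.smul_sum]
  refine Finset.sum_congr rfl fun i _ ↦ ?_
  rw [Finset.smul_sum]
  refine Finset.sum_congr rfl fun j _ ↦ ?_
  have h (a b : 𝔤) (z : Fin k → 𝔤) : bracketWedge 𝔤 k a b z =
      exteriorPower.ιMulti ℝ (k + 1) (Matrix.vecCons ⁅a, b⁆ z) := rfl
  have h' (a b : 𝔤) (z : Fin k → 𝔤) : bracketWedge 𝔤 k b a z = - bracketWedge 𝔤 k a b z := by
    change (exteriorPower.ιMulti ℝ (k + 1) (M := 𝔤)).curryLeft ⁅b, a⁆ z =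
      -(exteriorPower.ιMulti ℝ (k + 1) (M := 𝔤)).curryLeft ⁅a, b⁆ z
    rw [← lie_skew, map_neg, AlternatingMap.neg_apply]
  rw [h' (x i.castSucc) (x j.succ), h]
  generalize exteriorPower.ιMulti ℝ (k + 1) (M := 𝔤) _ = q
  rw [← Int.cast_smul_eq_zsmul ℝ]
  push_cast
  rw [Fin.val_castSucc, Fin.val_succ, ← add_assoc, pow_succ]
  module

/-- The alternating map `(x_0, …, x_{k+1}) ↦ ∂(x_0 ∧ ⋯ ∧ x_{k+1})`. -/
def lieBoundaryAlt (k : ℕ) : 𝔤 [⋀^Fin (k + 2)]→ₗ[ℝ] ⋀[ℝ]^(k + 1) 𝔤 where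
  toFun := lieBoundaryFormula 𝔤 k
  map_update_add' u i a b := by
    simp only [lieBoundaryFormula_eq, AlternatingMap.map_update_add, smul_add]
  map_update_smul' u i c a := by
    simp only [lieBoundaryFormula_eq, AlternatingMap.map_update_smul, smul_comm c]
  map_eq_zero_of_eq' u i j h hij := by
    rw [lieBoundaryFormula_eq, AlternatingMap.map_eq_zero_of_eq _ _ h hij, smul_zero]

/-- The Lie algebra homology differential `∂_{k+1} : Λ^{k+1} 𝔤 → Λ^k 𝔤`. For `k = 0` the defining
sum is empty. -/
def lieBoundary : (k : ℕ) → ⋀[ℝ]^(k + 1) 𝔤 →ₗ[ℝ] ⋀[ℝ]^k 𝔤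
  | 0 => 0
  | k + 1 => exteriorPower.alternatingMapLinearEquiv (lieBoundaryAlt 𝔤 k)

/-- The boundaries `B_k(𝔤) = im ∂_{k+1} ⊆ Λ^k 𝔤`. -/
def boundaries (k : ℕ) : Submodule ℝ (⋀[ℝ]^k 𝔤) := LinearMap.range (lieBoundary 𝔤 k)

end Homology

section Forms

variable (E : Type*) [NormedAddCommGroup E] [NormedSpace ℝ E]
  (M : Type*) [TopologicalSpace M] [ChartedSpace E M]

/-- Pointwise differential `k`-forms (no regularity) on a manifold `M` modelled on `E`. -/
abbrev DiffForm (k : ℕ) : Type _ :=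
  (x : M) → TangentSpace 𝓘(ℝ, E) x [⋀^Fin k]→L[ℝ] ℝ

/-- The space `𝔛(M)` of smooth vector fields. -/
abbrev VectorField [IsManifold 𝓘(ℝ, E) ∞ M] : Type _ :=
  Cₛ^∞⟮𝓘(ℝ, E); E, (TangentSpace 𝓘(ℝ, E) : M → Type _)⟯

variable {E M}

/-- The expression of a form in the chart at `x₀`: its pullback by the inverse of the chart. -/
def DiffForm.inChart {k : ℕ} (η : DiffForm E M k) (x₀ : M) (y : E) : E [⋀^Fin k]→L[ℝ] ℝ :=
  ContinuousAlternatingMap.compContinuousLinearMap (M := E) (M' := E)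
    (η ((extChartAt 𝓘(ℝ, E) x₀).symm y))
    (mfderiv 𝓘(ℝ, E) 𝓘(ℝ, E) (extChartAt 𝓘(ℝ, E) x₀).symm y)

variable (E M) in
/-- The space `Ω^k(M)` of smooth `k`-forms: the forms whose expression in every chart is smooth. -/
def smoothForms (k : ℕ) : Submodule ℝ (DiffForm E M k) where
  carrier := {η | ∀ x₀ : M, ContDiffOn ℝ ∞ (η.inChart x₀) (extChartAt 𝓘(ℝ, E) x₀).target}
  zero_mem' := fun _ ↦ contDiffOn_const (c := (0 : E [⋀^Fin k]→L[ℝ] ℝ))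
  add_mem' := fun h₁ h₂ x₀ ↦ (h₁ x₀).add (h₂ x₀)
  smul_mem' := fun c _ h x₀ ↦ (h x₀).const_smul c

/-- The exterior derivative, computed at each point `x` in the chart at `x`. -/
def extD {k : ℕ} (η : DiffForm E M k) : DiffForm E M (k + 1) := fun x ↦
  ContinuousAlternatingMap.compContinuousLinearMap (M := E) (M' := E)
    (extDeriv (η.inChart x) (extChartAt 𝓘(ℝ, E) x x))
    (mfderiv 𝓘(ℝ, E) 𝓘(ℝ, E) (extChartAt 𝓘(ℝ, E) x) x)

def IsClosedForm {k : ℕ} (η : DiffForm E M k) : Prop := extD η = 0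

/-- Exactness; as there are no nonzero forms of degree `-1`, the only exact function is `0`. -/
def IsExactForm : {k : ℕ} → DiffForm E M k → Prop
  | 0, α => α = 0
  | k + 1, α => ∃ β ∈ smoothForms E M k, α = extD β

/-- Regard a `k`-form as an `l`-form when `k = l`. -/
def DiffForm.cast {k l : ℕ} (h : k = l) (η : DiffForm E M k) : DiffForm E M l := h ▸ η

variable [IsManifold 𝓘(ℝ, E) ∞ M]

/-- The interior product `ι_v η = η(v, ⋯)`. -/
def interiorProd {k : ℕ} (v : VectorField E M) (η : DiffForm E M (k + 1)) : DiffForm E M k :=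
  fun x ↦ ContinuousAlternatingMap.curryLeft (E := E) (η x) (v x)

/-- The Lie derivative `L_v = d ι_v + ι_v d`, where `ι_v` vanishes on functions. -/
def lieDerivative (v : VectorField E M) : {k : ℕ} → DiffForm E M k → DiffForm E M k
  | 0, α => interiorProd v (extD α)
  | _ + 1, α => extD (interiorProd v α) + interiorProd v (extD α)

/-- `α` is globally conserved by `v` if `L_v α` is exact. -/
def IsGloballyConserved {k : ℕ} (v : VectorField E M) (α : DiffForm E M k) : Prop :=
  IsExactForm (lieDerivative v α)

/-- `v` is a Hamiltonian vector field of the `(n-1)`-form `α` with respect to the `(n+1)`-form `η`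
(with `n = m + 1`): `dα = - ι_v η`. -/
def IsHamiltonianVectorField {m : ℕ} (η : DiffForm E M (m + 2)) (α : DiffForm E M m)
    (v : VectorField E M) : Prop :=
  extD α = - interiorProd v η

/-- `α` is a Hamiltonian `(n-1)`-form with respect to the `(n+1)`-form `η` (with `n = m + 1`). -/
def IsHamiltonianForm {m : ℕ} (η : DiffForm E M (m + 2)) (α : DiffForm E M m) : Prop :=
  α ∈ smoothForms E M m ∧ ∃ v : VectorField E M, IsHamiltonianVectorField η α v

end Forms

section Actions

variable (E : Type*) [NormedAddCommGroup E] [NormedSpace ℝ E]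
  (M : Type*) [TopologicalSpace M] [ChartedSpace E M] [IsManifold 𝓘(ℝ, E) ∞ M]
  (𝔤 : Type*) [LieRing 𝔤] [LieAlgebra ℝ 𝔤]

/-- An infinitesimal right action of `𝔤` on `M`: a Lie algebra homomorphism `𝔤 → 𝔛(M)`. -/
structure InfinitesimalAction where
  field : 𝔤 →ₗ[ℝ] VectorField E M
  field_lie : ∀ (x y : 𝔤) (q : M),
    field ⁅x, y⁆ q = _root_.VectorField.mlieBracket 𝓘(ℝ, E) (field x) (field y) q

variable {E M 𝔤}

namespace InfinitesimalAction

variable (v : InfinitesimalAction E M 𝔤)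

/-- The action preserves `η`: `L_{v_x} η = 0` for all `x`. -/
def IsMultisymplectic {k : ℕ} (η : DiffForm E M k) : Prop :=
  ∀ x : 𝔤, lieDerivative (v.field x) η = 0

/-- The action is locally `H`-preserving: `L_{v_x} H` is closed for all `x`. -/
def LocallyPreserves {k : ℕ} (H : DiffForm E M k) : Prop :=
  ∀ x : 𝔤, IsClosedForm (lieDerivative (v.field x) H)

/-- The linear map `𝔤 → T_q M`, `x ↦ v_x(q)`. -/
def fieldAt (q : M) : 𝔤 →ₗ[ℝ] E where
  toFun x := v.field x q
  map_add' x y := by rw [map_add]; rfl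
  map_smul' c x := by rw [map_smul]; rfl

/-- The contraction `ι(v_p) η`, where `v_p = v_{x_1} ∧ ⋯ ∧ v_{x_k}` for `p = x_1 ∧ ⋯ ∧ x_k`,
extended linearly to all `p ∈ Λ^k 𝔤`. -/
def contraction {k l : ℕ} (p : ⋀[ℝ]^k 𝔤) (η : DiffForm E M (l + k)) : DiffForm E M l := fun q ↦
  contract (V := E) (η q) (exteriorPower.map k (v.fieldAt q) p)

end InfinitesimalAction

/-- The sign `ς(k) = -(-1)^{k(k+1)/2}`. -/
def sgn (k : ℕ) : ℝ := -(-1) ^ (k * (k + 1) / 2)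

/-- An `L_∞`-morphism from `𝔤` to the Lie `n`-algebra of observables of the pre-`n`-plectic
manifold `(M, η)` covering the action `v`, where `n = m + 1`. The component `f_i : Λ^i 𝔤 → Ω^j(M)`,
`j = n - i`, is `component i j _`, and `f_0 = 0`. The defining equation
`-f_{k-1}(∂p) = d f_k(p) + ς(k) ι(v_p) η` is `main` for `k = i + 1 ≤ n`,
and `main_top` for `k = n + 1`, where the term with `f_{n+1} = 0` is absent. -/
structure LInftyMorphism {m : ℕ} (η : DiffForm E M (m + 2)) (v : InfinitesimalAction E M 𝔤) where
  component : (i j : ℕ) → i + j = m + 1 → (⋀[ℝ]^i 𝔤 →ₗ[ℝ] smoothForms E M j)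
  component_zero : ∀ (j : ℕ) (h : 0 + j = m + 1), component 0 j h = 0
  isHamiltonian : ∀ p : ⋀[ℝ]^1 𝔤,
    IsHamiltonianForm η (component 1 m (Nat.add_comm 1 m) p : DiffForm E M m)
  main : ∀ (i j : ℕ) (h : (i + 1) + j = m + 1) (p : ⋀[ℝ]^(i + 1) 𝔤),
    -(component i (j + 1) (by omega) (lieBoundary 𝔤 i p) : DiffForm E M (j + 1)) =
      extD (component (i + 1) j h p : DiffForm E M j) +
        sgn (i + 1) • v.contraction p (η.cast (show m + 2 = (j + 1) + (i + 1) by omega))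
  main_top : ∀ p : ⋀[ℝ]^(m + 2) 𝔤,
    -(component (m + 1) 0 rfl (lieBoundary 𝔤 (m + 1) p) : DiffForm E M 0) =
      sgn (m + 2) • v.contraction p (η.cast (show m + 2 = 0 + (m + 2) by omega))

/-- A (homotopy) co-momentum map for the action `v`: an `L_∞`-morphism such that
`d(f_1(x)) = -ι_{v_x} η` for all `x ∈ 𝔤`. -/
structure CoMomentumMap {m : ℕ} (η : DiffForm E M (m + 2)) (v : InfinitesimalAction E M 𝔤)
    extends LInftyMorphism η v where
  moment : ∀ x : 𝔤, IsHamiltonianVectorField η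
    (component 1 m (Nat.add_comm 1 m) (exteriorPower.ιMulti ℝ 1 ![x]) : DiffForm E M m)
    (v.field x)

end Actions

end Multisymplectic

end

/-!
Taking `d` of the defining equation of `f`, evaluated on `q ∈ Λ^{k+1} 𝔤`, gives
`-d f_k(∂q) = ς(k+1) d ι(v_q) ω`. For a closed form `θ` preserved by the action, the multi-Cartan
formula reads `d ι(v_q) θ = (-1)^{k+1} ι(v_{∂q}) θ`; it follows by induction on `k` from
`∂(x ∧ p) = -ad_x p - x ∧ ∂p` and the derivation property of `L_{v_x}` on `ι(v_p) θ`. With `θ = ω`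
it shows `d f_k(∂q) = ± ι(v_{∂q}) ω`. Contracting with `v_H` turns `ω` into `∓ dH`, and `dH` is
itself closed and preserved by the action because `L_{v_x} H` is closed. So the multi-Cartan formula
with `θ = dH` shows that `ι_{v_H} d f_k(∂q)` is exact, and it differs from `L_{v_H} f_k(∂q)` by an
exact form. In degree `0`, where exact means zero, `ι(v_q) dH` vanishes for degree reasons, and the
induction step of the formula then gives `ι(v_{∂q}) dH = 0`.
-/

noncomputable section

namespace Multisymplectic

section ExteriorPower

variable {R V N : Type*} [CommRing R] [AddCommGroup V] [Module R V] [AddCommGroup N] [Module R N]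
  {k : ℕ}

theorem removeNth_zero_vecCons {α : Type*} (a : α) (z : Fin k → α) :
    (0 : Fin (k + 1)).removeNth (Matrix.vecCons a z) = z := rfl

theorem removeNth_succ_vecCons {α : Type*} (a : α) (z : Fin (k + 1) → α) (i : Fin (k + 1)) :
    i.succ.removeNth (Matrix.vecCons a z) = Matrix.vecCons a (i.removeNth z) := by
  ext j
  cases j using Fin.cases <;> simp [Fin.removeNth]

theorem update_zero_vecCons {α : Type*} (a b : α) (z : Fin k → α) :
    Function.update (Matrix.vecCons a z) 0 b = Matrix.vecCons b z :=
  Fin.update_cons_zero (α := fun _ ↦ α) a z b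

theorem update_succ_vecCons {α : Type*} (a b : α) (z : Fin k → α) (i : Fin k) :
    Function.update (Matrix.vecCons a z) i.succ b = Matrix.vecCons a (Function.update z i b) :=
  (Fin.cons_update (α := fun _ ↦ α) a z i b).symm

theorem alternatingMap_vecCons_swap (g : V [⋀^Fin (k + 2)]→ₗ[R] N) (a b : V) (z : Fin k → V) :
    g (Matrix.vecCons a (Matrix.vecCons b z)) = -g (Matrix.vecCons b (Matrix.vecCons a z)) := by
  have h := DFunLike.congr_fun (g.curryLeft_same (a + b)) z
  simp only [map_add, AlternatingMap.curryLeft_add, LinearMap.add_apply, AlternatingMap.add_apply,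
    AlternatingMap.curryLeft_same, AlternatingMap.curryLeft_apply_apply, AlternatingMap.zero_apply,
    zero_add, add_zero] at h
  exact eq_neg_of_add_eq_zero_right h

theorem alternatingMap_update (g : V [⋀^Fin (k + 1)]→ₗ[R] N) (z : Fin (k + 1) → V)
    (j : Fin (k + 1)) (a : V) :
    g (Function.update z j a) = (-1 : ℤ) ^ (j : ℕ) • g (Matrix.vecCons a (j.removeNth z)) := by
  rw [← Fin.insertNth_removeNth, g.map_insertNth]

/-- The product `x ∧ p`, bilinear in `x ∈ V` and `p ∈ Λ^k V`. -/
def wedge : V →ₗ[R] ⋀[R]^k V →ₗ[R] ⋀[R]^(k + 1) V :=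
  exteriorPower.alternatingMapLinearEquiv.toLinearMap ∘ₗ
    (exteriorPower.ιMulti R (k + 1)).curryLeft

theorem wedge_ιMulti (x : V) (z : Fin k → V) :
    wedge x (exteriorPower.ιMulti R k z) = exteriorPower.ιMulti R (k + 1) (Matrix.vecCons x z) :=
  exteriorPower.alternatingMapLinearEquiv_apply_ιMulti _ z

theorem wedge_induction {P : ⋀[R]^(k + 1) V → Prop} (wedge : ∀ x p, P (wedge x p))
    (add : ∀ p q, P p → P q → P (p + q)) (p : ⋀[R]^(k + 1) V) : P p := by
  suffices h : ∀ c : R, P (c • p) by simpa only [one_smul] using h 1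
  have hp : p ∈ Submodule.span R (Set.range (exteriorPower.ιMulti R (k + 1) (M := V))) := by
    rw [exteriorPower.ιMulti_span]
    trivial
  induction hp using Submodule.span_induction with
  | mem _ h =>
    obtain ⟨z, rfl⟩ := h
    intro c
    rw [← Matrix.cons_head_tail z, ← wedge_ιMulti, ← LinearMap.map_smul₂]
    exact wedge _ _
  | zero => intro c; simpa only [map_zero, smul_zero] using wedge 0 0
  | add _ _ _ _ h₁ h₂ => intro c; simpa only [smul_add] using add _ _ (h₁ c) (h₂ c)
  | smul a _ _ h => intro c; simpa only [smul_smul] using h (c * a)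

theorem map_wedge (g : V →ₗ[R] N) (x : V) (p : ⋀[R]^k V) :
    exteriorPower.map (k + 1) g (wedge x p) = wedge (g x) (exteriorPower.map k g p) := by
  suffices h : exteriorPower.map (k + 1) g ∘ₗ wedge x = wedge (g x) ∘ₗ exteriorPower.map k g from
    DFunLike.congr_fun h p
  refine exteriorPower.linearMap_ext (AlternatingMap.ext fun z ↦ ?_)
  simp only [LinearMap.compAlternatingMap_apply, LinearMap.comp_apply, wedge_ιMulti,
    exteriorPower.map_apply_ιMulti]
  exact congrArg _ (Fin.comp_cons g x z)

end ExteriorPower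

section Homology

variable {𝔤 : Type*} [LieRing 𝔤] [LieAlgebra ℝ 𝔤] {k : ℕ}

theorem lieBoundary_ιMulti (x : Fin (k + 2) → 𝔤) :
    lieBoundary 𝔤 (k + 1) (exteriorPower.ιMulti ℝ (k + 2) x) = lieBoundaryFormula 𝔤 k x :=
  exteriorPower.alternatingMapLinearEquiv_apply_ιMulti (lieBoundaryAlt 𝔤 k) x

theorem sum_Ici_succ {N : Type*} [AddCommMonoid N] (i : Fin k) (φ : Fin (k + 1) → N) :
    ∑ j ≥ i.succ, φ j = ∑ j ≥ i, φ j.succ := by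
  rw [← Fin.map_succEmb_Ici, Finset.sum_map]
  rfl

theorem lieBoundary_ιMulti_vecCons (x : 𝔤) (z : Fin (k + 1) → 𝔤) :
    lieBoundary 𝔤 (k + 1) (exteriorPower.ιMulti ℝ (k + 2) (Matrix.vecCons x z)) =
      -(∑ j, exteriorPower.ιMulti ℝ (k + 1) (Function.update z j ⁅x, z j⁆)) -
        wedge x (lieBoundary 𝔤 k (exteriorPower.ιMulti ℝ (k + 1) z)) := by
  rw [lieBoundary_ιMulti, lieBoundaryFormula, Fin.sum_univ_succ, sub_eq_add_neg]
  congr 1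
  · rw [show Finset.Ici (0 : Fin (k + 1)) = Finset.univ from Finset.Ici_bot,
      ← Finset.sum_neg_distrib]
    refine Finset.sum_congr rfl fun j _ ↦ ?_
    rw [alternatingMap_update, ← Int.cast_smul_eq_zsmul ℝ, Fin.castSucc_zero,
      removeNth_zero_vecCons, Matrix.cons_val_zero, Matrix.cons_val_succ, Fin.val_succ,
      Fin.val_zero, zero_add, pow_succ]
    push_cast
    module
  · cases k with
    | zero => simp [lieBoundary]
    | succ k =>
      simp only [lieBoundary_ιMulti, lieBoundaryFormula, map_sum, map_smul,
        ← Finset.sum_neg_distrib, sum_Ici_succ]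
      refine Finset.sum_congr rfl fun i _ ↦ Finset.sum_congr rfl fun j _ ↦ ?_
      rw [← Fin.succ_castSucc, removeNth_succ_vecCons, removeNth_succ_vecCons,
        alternatingMap_vecCons_swap, wedge_ιMulti, Matrix.cons_val_succ, Matrix.cons_val_succ]
      simp only [Fin.val_succ, Fin.val_castSucc, pow_add, pow_one]
      module

/-- The adjoint action of `x` on `Λ^k 𝔤`, as the derivation extending `ad_x`. It is encoded by the
homotopy formula `ad_x = -(∂ (x ∧ ·) + x ∧ ∂ ·)`, which spares checking that the sum
`∑ⱼ z₁ ∧ ⋯ ∧ [x, zⱼ] ∧ ⋯ ∧ z_k` is alternating. -/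
def adWedge (x : 𝔤) : (k : ℕ) → ⋀[ℝ]^k 𝔤 →ₗ[ℝ] ⋀[ℝ]^k 𝔤
  | 0 => 0
  | k + 1 => -(lieBoundary 𝔤 (k + 1) ∘ₗ wedge x + wedge x ∘ₗ lieBoundary 𝔤 k)

theorem lieBoundary_wedge (x : 𝔤) (p : ⋀[ℝ]^(k + 1) 𝔤) :
    lieBoundary 𝔤 (k + 1) (wedge x p) = -adWedge x (k + 1) p - wedge x (lieBoundary 𝔤 k p) := by
  rw [adWedge, LinearMap.neg_apply, LinearMap.add_apply, LinearMap.comp_apply, LinearMap.comp_apply]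
  abel

theorem adWedge_ιMulti (x : 𝔤) (z : Fin k → 𝔤) :
    adWedge x k (exteriorPower.ιMulti ℝ k z) =
      ∑ j, exteriorPower.ιMulti ℝ k (Function.update z j ⁅x, z j⁆) := by
  cases k with
  | zero => rw [adWedge, LinearMap.zero_apply, Fin.sum_univ_zero]
  | succ k =>
    have h := lieBoundary_wedge x (exteriorPower.ιMulti ℝ (k + 1) z)
    rw [wedge_ιMulti, lieBoundary_ιMulti_vecCons] at h
    exact (neg_injective (sub_left_injective h)).symm

theorem adWedge_wedge (x y : 𝔤) (p : ⋀[ℝ]^k 𝔤) :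
    adWedge x (k + 1) (wedge y p) = wedge ⁅x, y⁆ p + wedge y (adWedge x k p) := by
  suffices h : adWedge x (k + 1) ∘ₗ wedge y = wedge ⁅x, y⁆ + wedge y ∘ₗ adWedge x k from
    DFunLike.congr_fun h p
  refine exteriorPower.linearMap_ext (AlternatingMap.ext fun z ↦ ?_)
  simp only [LinearMap.compAlternatingMap_apply, LinearMap.comp_apply, LinearMap.add_apply,
    wedge_ιMulti, adWedge_ιMulti, map_sum, Fin.sum_univ_succ, update_zero_vecCons,
    update_succ_vecCons, Matrix.cons_val_zero, Matrix.cons_val_succ]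

end Homology

section Coordinates

variable {𝕜 E F : Type*} [NontriviallyNormedField 𝕜] [NormedAddCommGroup E] [NormedSpace 𝕜 E]
  [NormedAddCommGroup F] [NormedSpace 𝕜 F] {k : ℕ} {V W : E → E} {y : E}

theorem isBoundedBilinearMap_curryLeft : IsBoundedBilinearMap 𝕜
    fun p : (E [⋀^Fin (k + 1)]→L[𝕜] F) × E ↦ p.1.curryLeft p.2 :=
  ContinuousLinearMap.isBoundedBilinearMap (G := E [⋀^Fin k]→L[𝕜] F)
    ContinuousAlternatingMap.curryLeftLI.toContinuousLinearMap

theorem contDiffOn_curryLeft {n : WithTop ℕ∞} {A : E → E [⋀^Fin (k + 1)]→L[𝕜] F} {s : Set E}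
    (hA : ContDiffOn 𝕜 n A s) (hV : ContDiffOn 𝕜 n V s) :
    ContDiffOn 𝕜 n (fun z ↦ (A z).curryLeft (V z)) s :=
  have h : ContDiff 𝕜 n fun p : (E [⋀^Fin (k + 1)]→L[𝕜] F) × E ↦ p.1.curryLeft p.2 :=
    isBoundedBilinearMap_curryLeft.contDiff
  h.comp₂_contDiffOn hA hV

theorem fderiv_curryLeft_apply {A : E → E [⋀^Fin (k + 1)]→L[𝕜] F}
    (hA : DifferentiableAt 𝕜 A y) (hV : DifferentiableAt 𝕜 V y) (h : E) :
    fderiv 𝕜 (fun z ↦ (A z).curryLeft (V z)) y h =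
      (A y).curryLeft (fderiv 𝕜 V y h) + (fderiv 𝕜 A y h).curryLeft (V y) := by
  have hcurry := isBoundedBilinearMap_curryLeft.hasFDerivAt (𝕜 := 𝕜) (A y, V y)
  have hAV := hcurry.comp y (hA.hasFDerivAt.prodMk hV.hasFDerivAt)
  exact DFunLike.congr_fun hAV.fderiv h

/-- The coordinate expression of the Lie derivative `L_V A` at `y`, evaluated on the vectors `u`:
the derivative of the coefficients of `A` along `V`, corrected by the derivative of `V` in each
slot. -/
def lieDerivApply (V : E → E) (A : E → E [⋀^Fin k]→L[𝕜] F) (y : E) (u : Fin k → E) : F :=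
  fderiv 𝕜 A y (V y) u + ∑ i, A y (Function.update u i (fderiv 𝕜 V y (u i)))

theorem lieDerivApply_congr {A B : E → E [⋀^Fin k]→L[𝕜] F} (V : E → E) (h : A =ᶠ[nhds y] B) :
    lieDerivApply (𝕜 := 𝕜) V A y = lieDerivApply V B y := by
  ext u
  rw [lieDerivApply, lieDerivApply, h.fderiv_eq, h.self_of_nhds]

theorem curryLeft_extDeriv_eq_lieDerivApply (A : E → E [⋀^Fin 0]→L[𝕜] F) (V : E → E) (y : E)
    (u : Fin 0 → E) : (extDeriv A y).curryLeft (V y) u = lieDerivApply V A y u := by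
  rw [ContinuousAlternatingMap.curryLeft_apply_apply, extDeriv,
    ContinuousAlternatingMap.alternatizeUncurryFin_apply]
  simp [lieDerivApply]

theorem extDeriv_curryLeft_add_curryLeft_extDeriv {A : E → E [⋀^Fin (k + 1)]→L[𝕜] F}
    (hA : DifferentiableAt 𝕜 A y) (hV : DifferentiableAt 𝕜 V y) (u : Fin (k + 1) → E) :
    extDeriv (fun z ↦ (A z).curryLeft (V z)) y u + (extDeriv A y).curryLeft (V y) u =
      lieDerivApply V A y u := by
  have hι : extDeriv (fun z ↦ (A z).curryLeft (V z)) y u =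
      ∑ i, A y (Function.update u i (fderiv 𝕜 V y (u i))) +
        ∑ i : Fin (k + 1), (-1 : ℤ) ^ (i : ℕ) •
          fderiv 𝕜 A y (u i) (Matrix.vecCons (V y) (i.removeNth u)) := by
    rw [extDeriv, ContinuousAlternatingMap.alternatizeUncurryFin_apply, ← Finset.sum_add_distrib]
    refine Finset.sum_congr rfl fun i _ ↦ ?_
    rw [fderiv_curryLeft_apply hA hV, ContinuousAlternatingMap.add_apply, smul_add]
    exact congrArg (· + _) (alternatingMap_update (A y).toAlternatingMap u i _).symm
  have hd : (extDeriv A y).curryLeft (V y) u = fderiv 𝕜 A y (V y) u -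
      ∑ i : Fin (k + 1), (-1 : ℤ) ^ (i : ℕ) •
        fderiv 𝕜 A y (u i) (Matrix.vecCons (V y) (i.removeNth u)) := by
    rw [ContinuousAlternatingMap.curryLeft_apply_apply, extDeriv,
      ContinuousAlternatingMap.alternatizeUncurryFin_apply, Fin.sum_univ_succ, sub_eq_add_neg,
      ← Finset.sum_neg_distrib]
    simp only [removeNth_zero_vecCons, removeNth_succ_vecCons, Matrix.cons_val_zero,
      Matrix.cons_val_succ, Fin.val_zero, Fin.val_succ, pow_zero, one_smul, pow_succ, mul_neg_one,
      neg_smul]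
  rw [hι, hd, lieDerivApply]
  abel

theorem lieDerivApply_curryLeft {A : E → E [⋀^Fin (k + 1)]→L[𝕜] F}
    (hA : DifferentiableAt 𝕜 A y) (hW : DifferentiableAt 𝕜 W y) (u : Fin k → E) :
    lieDerivApply V (fun z ↦ (A z).curryLeft (W z)) y u =
      lieDerivApply V A y (Matrix.vecCons (W y) u) +
        (A y).curryLeft (VectorField.lieBracket 𝕜 V W y) u := by
  simp only [lieDerivApply, fderiv_curryLeft_apply hA hW, VectorField.lieBracket_eq, map_sub,
    ContinuousAlternatingMap.add_apply, ContinuousAlternatingMap.sub_apply,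
    ContinuousAlternatingMap.curryLeft_apply_apply, Fin.sum_univ_succ, update_zero_vecCons,
    update_succ_vecCons, Matrix.cons_val_zero, Matrix.cons_val_succ]
  abel

end Coordinates

section Charts

theorem minSmoothness_two_le_infty : minSmoothness ℝ 2 ≤ (∞ : WithTop ℕ∞) := by
  rw [minSmoothness_of_isRCLikeNormedField]
  exact WithTop.coe_le_coe.2 le_top

variable {E : Type*} [NormedAddCommGroup E] [NormedSpace ℝ E]
  {M : Type*} [TopologicalSpace M] [ChartedSpace E M] {k : ℕ} {x₀ x₁ : M} {y : E}

/-- The derivative at `x` of the chart at `x₀`, with the tangent spaces identified with the model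
space `E`. -/
def chartDeriv (x₀ x : M) : E →L[ℝ] E := mfderiv 𝓘(ℝ, E) 𝓘(ℝ, E) (extChartAt 𝓘(ℝ, E) x₀) x

/-- The derivative at `y` of the inverse of the chart at `x₀`, with the tangent spaces identified
with the model space `E`. -/
def chartSymmDeriv (x₀ : M) (y : E) : E →L[ℝ] E :=
  mfderiv 𝓘(ℝ, E) 𝓘(ℝ, E) (extChartAt 𝓘(ℝ, E) x₀).symm y

/-- The transition map from the chart at `x₀` to the chart at `x₁`. -/
def transition (x₀ x₁ : M) (y : E) : E :=
  extChartAt 𝓘(ℝ, E) x₁ ((extChartAt 𝓘(ℝ, E) x₀).symm y)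

theorem target_mem_nhds (hy : y ∈ (extChartAt 𝓘(ℝ, E) x₀).target) :
    (extChartAt 𝓘(ℝ, E) x₀).target ∈ nhds y :=
  (isOpen_extChartAt_target x₀).mem_nhds hy

theorem inChart_apply (η : DiffForm E M k) (x₀ : M) (y : E) (u : Fin k → E) :
    η.inChart x₀ y u = η ((extChartAt 𝓘(ℝ, E) x₀).symm y) (chartSymmDeriv x₀ y ∘ u) := rfl

theorem differentiableAt_inChart {η : DiffForm E M k} (hη : η ∈ smoothForms E M k)
    (hy : y ∈ (extChartAt 𝓘(ℝ, E) x₀).target) : DifferentiableAt ℝ (η.inChart x₀) y :=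
  ((hη x₀).contDiffAt (target_mem_nhds hy)).differentiableAt (by simp)

variable [IsManifold 𝓘(ℝ, E) ∞ M]

theorem chartDeriv_self (x : M) : chartDeriv (E := E) x x = ContinuousLinearMap.id ℝ E :=
  mfderiv_extChartAt_self

theorem chartSymmDeriv_self (x : M) :
    chartSymmDeriv x (extChartAt 𝓘(ℝ, E) x x) = ContinuousLinearMap.id ℝ E := by
  have h := mfderivWithin_range_extChartAt_symm (I := 𝓘(ℝ, E)) (x := x)
  rwa [ModelWithCorners.range_eq_univ, mfderivWithin_univ] at h

theorem inChart_self (η : DiffForm E M k) (x : M) :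
    η.inChart x (extChartAt 𝓘(ℝ, E) x x) = η x := by
  ext u
  rw [inChart_apply, extChartAt_to_inv, chartSymmDeriv_self]
  rfl

theorem ext_inChart {η θ : DiffForm E M k} (h : ∀ x : M,
    η.inChart x (extChartAt 𝓘(ℝ, E) x x) = θ.inChart x (extChartAt 𝓘(ℝ, E) x x)) : η = θ :=
  funext fun x ↦ (inChart_self η x).symm.trans ((h x).trans (inChart_self θ x))

theorem inChart_extD_self (η : DiffForm E M k) (x : M) :
    (extD η).inChart x (extChartAt 𝓘(ℝ, E) x x) =
      extDeriv (η.inChart x) (extChartAt 𝓘(ℝ, E) x x) := by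
  rw [inChart_self]
  change (extDeriv (η.inChart x) (extChartAt 𝓘(ℝ, E) x x)).compContinuousLinearMap
    (chartDeriv x x) = _
  rw [chartDeriv_self]
  rfl

theorem chartDeriv_comp_chartSymmDeriv (hy : y ∈ (extChartAt 𝓘(ℝ, E) x₀).target) :
    chartDeriv x₀ ((extChartAt 𝓘(ℝ, E) x₀).symm y) ∘L chartSymmDeriv x₀ y =
      ContinuousLinearMap.id ℝ E := by
  have h := mfderiv_extChartAt_comp_mfderivWithin_extChartAt_symm (I := 𝓘(ℝ, E)) hy
  rwa [ModelWithCorners.range_eq_univ, mfderivWithin_univ] at h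

theorem chartSymmDeriv_comp_chartDeriv (hy : y ∈ (extChartAt 𝓘(ℝ, E) x₀).target) :
    chartSymmDeriv x₀ y ∘L chartDeriv x₀ ((extChartAt 𝓘(ℝ, E) x₀).symm y) =
      ContinuousLinearMap.id ℝ E := by
  have h := mfderivWithin_extChartAt_symm_comp_mfderiv_extChartAt (I := 𝓘(ℝ, E)) hy
  rwa [ModelWithCorners.range_eq_univ, mfderivWithin_univ] at h

theorem contMDiffAt_extChartAt_symm (hy : y ∈ (extChartAt 𝓘(ℝ, E) x₀).target) :
    ContMDiffAt 𝓘(ℝ, E) 𝓘(ℝ, E) ∞ (extChartAt 𝓘(ℝ, E) x₀).symm y :=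
  (contMDiffOn_extChartAt_symm x₀).contMDiffAt (target_mem_nhds hy)

theorem contDiffAt_transition (hy : y ∈ (extChartAt 𝓘(ℝ, E) x₀).target)
    (hx : (extChartAt 𝓘(ℝ, E) x₀).symm y ∈ (chartAt E x₁).source) :
    ContDiffAt ℝ ∞ (transition (E := E) x₀ x₁) y :=
  contMDiffAt_iff_contDiffAt.1 <|
    ContMDiffAt.comp (I' := 𝓘(ℝ, E)) y (contMDiffAt_extChartAt' hx) (contMDiffAt_extChartAt_symm hy)

theorem fderiv_transition (hy : y ∈ (extChartAt 𝓘(ℝ, E) x₀).target)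
    (hx : (extChartAt 𝓘(ℝ, E) x₀).symm y ∈ (chartAt E x₁).source) :
    fderiv ℝ (transition (E := E) x₀ x₁) y =
      chartDeriv x₁ ((extChartAt 𝓘(ℝ, E) x₀).symm y) ∘L chartSymmDeriv x₀ y := by
  rw [← mfderiv_eq_fderiv]
  exact mfderiv_comp (I' := 𝓘(ℝ, E)) y (mdifferentiableAt_extChartAt hx)
    ((contMDiffAt_extChartAt_symm hy).mdifferentiableAt (by simp))

theorem inChart_eq_pullback_transition (η : DiffForm E M k)
    (hy : y ∈ (extChartAt 𝓘(ℝ, E) x₀).target)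
    (hx : (extChartAt 𝓘(ℝ, E) x₀).symm y ∈ (chartAt E x₁).source) :
    η.inChart x₀ y = (η.inChart x₁ (transition x₀ x₁ y)).compContinuousLinearMap
      (fderiv ℝ (transition (E := E) x₀ x₁) y) := by
  rw [← extChartAt_source 𝓘(ℝ, E)] at hx
  have hsymm : (extChartAt 𝓘(ℝ, E) x₁).symm (transition x₀ x₁ y) =
      (extChartAt 𝓘(ℝ, E) x₀).symm y := (extChartAt 𝓘(ℝ, E) x₁).left_inv hx
  have hderiv := chartSymmDeriv_comp_chartDeriv ((extChartAt 𝓘(ℝ, E) x₁).map_source hx)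
  rw [(extChartAt 𝓘(ℝ, E) x₁).left_inv hx] at hderiv
  ext u
  rw [ContinuousAlternatingMap.compContinuousLinearMap_apply, inChart_apply, inChart_apply, hsymm,
    fderiv_transition hy (by rwa [← extChartAt_source 𝓘(ℝ, E)])]
  exact congrArg (η _) (funext fun i ↦ (DFunLike.congr_fun hderiv (chartSymmDeriv x₀ y (u i))).symm)

theorem inChart_extD {η : DiffForm E M k} (hη : η ∈ smoothForms E M k)
    (hy : y ∈ (extChartAt 𝓘(ℝ, E) x₀).target) :
    (extD η).inChart x₀ y = extDeriv (η.inChart x₀) y := by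
  set x := (extChartAt 𝓘(ℝ, E) x₀).symm y
  have hx : x ∈ (chartAt E x).source := mem_chart_source E x
  have hpullback : η.inChart x₀ =ᶠ[nhds y] fun z ↦
      (η.inChart x (transition x₀ x z)).compContinuousLinearMap
        (fderiv ℝ (transition (E := E) x₀ x) z) := by
    filter_upwards [target_mem_nhds hy, (contMDiffAt_extChartAt_symm hy).continuousAt
      |>.preimage_mem_nhds ((chartAt E x).open_source.mem_nhds hx)] with z hz hz'
    exact inChart_eq_pullback_transition η hz hz'
  have htransition : transition x₀ x y = extChartAt 𝓘(ℝ, E) x x := rfl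
  rw [hpullback.extDeriv_eq, extDeriv_pullback (r := ∞) _ (contDiffAt_transition hy hx)
    minSmoothness_two_le_infty, inChart_eq_pullback_transition _ hy hx, htransition,
    inChart_extD_self]
  exact differentiableAt_inChart hη (mem_extChartAt_target x)

/-- The expression of a vector field in the chart at `x₀`: its pushforward by the chart. -/
def fieldInChart (v : VectorField E M) (x₀ : M) (y : E) : E :=
  chartDeriv x₀ ((extChartAt 𝓘(ℝ, E) x₀).symm y) (v ((extChartAt 𝓘(ℝ, E) x₀).symm y))

theorem fieldInChart_self (v : VectorField E M) (x : M) :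
    fieldInChart v x (extChartAt 𝓘(ℝ, E) x x) = v x := by
  rw [fieldInChart, extChartAt_to_inv, chartDeriv_self]
  rfl

theorem contDiffOn_fieldInChart (v : VectorField E M) (x₀ : M) :
    ContDiffOn ℝ ∞ (fieldInChart v x₀) (extChartAt 𝓘(ℝ, E) x₀).target := by
  set e := trivializationAt E (TangentSpace 𝓘(ℝ, E) : M → Type _) x₀
  have hv := (e.contMDiffOn_section_baseSet_iff (IB := 𝓘(ℝ, E)) (n := ∞)).1 v.contMDiff.contMDiffOn
  have hmaps : Set.MapsTo (extChartAt 𝓘(ℝ, E) x₀).symm (extChartAt 𝓘(ℝ, E) x₀).target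
      e.baseSet := fun y hy ↦ by
    have h := (extChartAt 𝓘(ℝ, E) x₀).map_target hy
    rwa [extChartAt_source] at h
  have hcomp := hv.comp (contMDiffOn_extChartAt_symm x₀) hmaps
  refine (contMDiffOn_iff_contDiffOn.1 hcomp).congr fun y hy ↦ ?_
  have h := e.continuousLinearMapAt_apply_of_mem (R := ℝ) (hmaps hy)
    (v ((extChartAt 𝓘(ℝ, E) x₀).symm y))
  rwa [TangentBundle.continuousLinearMapAt_trivializationAt (I := 𝓘(ℝ, E)) (hmaps hy)] at h

theorem differentiableAt_fieldInChart (v : VectorField E M)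
    (hy : y ∈ (extChartAt 𝓘(ℝ, E) x₀).target) : DifferentiableAt ℝ (fieldInChart v x₀) y :=
  ((contDiffOn_fieldInChart v x₀).contDiffAt (target_mem_nhds hy)).differentiableAt (by simp)

theorem inChart_interiorProd (v : VectorField E M) (η : DiffForm E M (k + 1))
    (hy : y ∈ (extChartAt 𝓘(ℝ, E) x₀).target) :
    (interiorProd v η).inChart x₀ y = (η.inChart x₀ y).curryLeft (fieldInChart v x₀ y) := by
  ext u
  rw [ContinuousAlternatingMap.curryLeft_apply_apply, inChart_apply, inChart_apply]
  refine congrArg (η _) (funext fun i ↦ ?_)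
  cases i using Fin.cases with
  | zero => exact (DFunLike.congr_fun (chartSymmDeriv_comp_chartDeriv hy) (v _)).symm
  | succ i => rfl

theorem inChart_interiorProd_eventuallyEq (v : VectorField E M) (η : DiffForm E M (k + 1))
    (hy : y ∈ (extChartAt 𝓘(ℝ, E) x₀).target) :
    (interiorProd v η).inChart x₀ =ᶠ[nhds y]
      fun z ↦ (η.inChart x₀ z).curryLeft (fieldInChart v x₀ z) :=
  Filter.eventuallyEq_of_mem (target_mem_nhds hy) fun _ hz ↦ inChart_interiorProd v η hz

theorem interiorProd_mem_smoothForms (v : VectorField E M) {η : DiffForm E M (k + 1)}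
    (hη : η ∈ smoothForms E M (k + 1)) : interiorProd v η ∈ smoothForms E M k := fun x₀ ↦
  (contDiffOn_curryLeft (hη x₀) (contDiffOn_fieldInChart v x₀)).congr fun _ hy ↦
    inChart_interiorProd v η hy

theorem extD_mem_smoothForms {η : DiffForm E M k} (hη : η ∈ smoothForms E M k) :
    extD η ∈ smoothForms E M (k + 1) := fun x₀ ↦ by
  have hderiv := (hη x₀).fderiv_of_isOpen (m := ∞) (isOpen_extChartAt_target x₀) (by simp)
  have halternatize :
      ContDiff ℝ ∞ (ContinuousAlternatingMap.alternatizeUncurryFinCLM (n := k) ℝ E ℝ) :=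
    ContinuousLinearMap.contDiff (E := E →L[ℝ] E [⋀^Fin k]→L[ℝ] ℝ) _
  exact (halternatize.comp_contDiffOn hderiv).congr fun y hy ↦ inChart_extD hη hy

theorem extD_extD {η : DiffForm E M k} (hη : η ∈ smoothForms E M k) : extD (extD η) = 0 :=
  ext_inChart fun x ↦ by
    have hx := mem_extChartAt_target (I := 𝓘(ℝ, E)) x
    have hd : (extD η).inChart x =ᶠ[nhds (extChartAt 𝓘(ℝ, E) x x)] extDeriv (η.inChart x) :=
      Filter.eventuallyEq_of_mem (target_mem_nhds hx) fun _ hy ↦ inChart_extD hη hy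
    rw [inChart_extD_self, hd.extDeriv_eq]
    exact extDeriv_extDeriv_apply ((hη x).contDiffAt (target_mem_nhds hx))
      minSmoothness_two_le_infty

theorem extD_add {η θ : DiffForm E M k} (hη : η ∈ smoothForms E M k)
    (hθ : θ ∈ smoothForms E M k) : extD (η + θ) = extD η + extD θ :=
  ext_inChart fun x ↦ by
    have hx := mem_extChartAt_target (I := 𝓘(ℝ, E)) x
    rw [inChart_extD_self]
    refine (extDeriv_add (differentiableAt_inChart hη hx) (differentiableAt_inChart hθ hx)).trans ?_
    rw [← inChart_extD_self, ← inChart_extD_self]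
    rfl

theorem extD_smul (c : ℝ) (η : DiffForm E M k) : extD (c • η) = c • extD η :=
  ext_inChart fun x ↦ by
    rw [inChart_extD_self]
    refine (extDeriv_smul c (η.inChart x)).trans ?_
    rw [← inChart_extD_self]
    rfl

theorem inChart_lieDerivative (v : VectorField E M) {η : DiffForm E M k}
    (hη : η ∈ smoothForms E M k) (hy : y ∈ (extChartAt 𝓘(ℝ, E) x₀).target) (u : Fin k → E) :
    (lieDerivative v η).inChart x₀ y u =
      lieDerivApply (fieldInChart v x₀) (η.inChart x₀) y u := by
  cases k with
  | zero =>
    rw [lieDerivative, inChart_interiorProd v _ hy, inChart_extD hη hy,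
      curryLeft_extDeriv_eq_lieDerivApply]
  | succ k =>
    have hι := inChart_interiorProd_eventuallyEq v η hy
    rw [← extDeriv_curryLeft_add_curryLeft_extDeriv (differentiableAt_inChart hη hy)
      (differentiableAt_fieldInChart v hy), ← hι.extDeriv_eq,
      ← inChart_extD (interiorProd_mem_smoothForms v hη) hy, ← inChart_extD hη hy,
      ← inChart_interiorProd v _ hy]
    rfl

theorem mpullbackWithin_eq_fieldInChart (v : VectorField E M)
    (hy : y ∈ (extChartAt 𝓘(ℝ, E) x₀).target) :
    _root_.VectorField.mpullbackWithin 𝓘(ℝ, E) 𝓘(ℝ, E) (extChartAt 𝓘(ℝ, E) x₀).symm v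
      (Set.range 𝓘(ℝ, E)) y = fieldInChart v x₀ y := by
  rw [ModelWithCorners.range_eq_univ, VectorField.mpullbackWithin_univ,
    VectorField.mpullback_apply]
  have hinv : (chartSymmDeriv x₀ y).inverse = chartDeriv x₀ ((extChartAt 𝓘(ℝ, E) x₀).symm y) :=
    ContinuousLinearMap.inverse_eq (chartSymmDeriv_comp_chartDeriv hy)
      (chartDeriv_comp_chartSymmDeriv hy)
  exact DFunLike.congr_fun hinv (v ((extChartAt 𝓘(ℝ, E) x₀).symm y))

theorem lieBracket_fieldInChart (v w : VectorField E M) (x : M) :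
    VectorField.lieBracket ℝ (fieldInChart v x) (fieldInChart w x) (extChartAt 𝓘(ℝ, E) x x) =
      (_root_.VectorField.mlieBracket 𝓘(ℝ, E) v w x : E) := by
  let pullback (u : VectorField E M) : E → E :=
    _root_.VectorField.mpullbackWithin 𝓘(ℝ, E) 𝓘(ℝ, E) (extChartAt 𝓘(ℝ, E) x).symm u
      (Set.range 𝓘(ℝ, E))
  have hpullback (u : VectorField E M) :
      fieldInChart u x =ᶠ[nhds (extChartAt 𝓘(ℝ, E) x x)] pullback u :=
    Filter.eventuallyEq_of_mem (target_mem_nhds (mem_extChartAt_target x)) fun _ hy ↦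
      (mpullbackWithin_eq_fieldInChart u hy).symm
  have hbracket : (_root_.VectorField.mlieBracket 𝓘(ℝ, E) v w x : E) =
      (chartDeriv (E := E) x x).inverse (VectorField.lieBracketWithin ℝ (pullback v) (pullback w)
        ((extChartAt 𝓘(ℝ, E) x).symm ⁻¹' Set.univ ∩ Set.range 𝓘(ℝ, E))
        (extChartAt 𝓘(ℝ, E) x x)) :=
    VectorField.mlieBracketWithin_apply (s := Set.univ)
  rw [(hpullback v).lieBracket_vectorField_eq (hpullback w), hbracket, chartDeriv_self,
    ContinuousLinearMap.inverse_id, Set.preimage_univ, Set.univ_inter,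
    ModelWithCorners.range_eq_univ, VectorField.lieBracketWithin_univ]
  rfl

theorem lieDerivative_interiorProd (v w b : VectorField E M)
    (hb : ∀ x, b x = _root_.VectorField.mlieBracket 𝓘(ℝ, E) v w x)
    {η : DiffForm E M (k + 1)} (hη : η ∈ smoothForms E M (k + 1)) :
    lieDerivative v (interiorProd w η) =
      interiorProd w (lieDerivative v η) + interiorProd b η :=
  ext_inChart fun x ↦ by
    have hx := mem_extChartAt_target (I := 𝓘(ℝ, E)) x
    ext u
    rw [inChart_lieDerivative v (interiorProd_mem_smoothForms w hη) hx,
      lieDerivApply_congr _ (inChart_interiorProd_eventuallyEq w η hx),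
      lieDerivApply_curryLeft (differentiableAt_inChart hη hx) (differentiableAt_fieldInChart w hx),
      ← inChart_lieDerivative v hη hx, lieBracket_fieldInChart, ← hb, ← fieldInChart_self b,
      ← ContinuousAlternatingMap.curryLeft_apply_apply,
      ← inChart_interiorProd w _ hx, ← inChart_interiorProd b η hx]
    rfl

end Charts

section CartanCalculus

variable {E : Type*} [NormedAddCommGroup E] [NormedSpace ℝ E]
  {M : Type*} [TopologicalSpace M] [ChartedSpace E M] [IsManifold 𝓘(ℝ, E) ∞ M] {k : ℕ}

theorem IsExactForm.smul {η : DiffForm E M k} (h : IsExactForm η) (c : ℝ) :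
    IsExactForm (c • η) := by
  cases k with
  | zero => exact (congrArg (c • ·) h).trans (smul_zero c)
  | succ k =>
    obtain ⟨β, hβ, rfl⟩ := h
    exact ⟨c • β, Submodule.smul_mem _ c hβ, (extD_smul c β).symm⟩

theorem interiorProd_add (v : VectorField E M) (η θ : DiffForm E M (k + 1)) :
    interiorProd v (η + θ) = interiorProd v η + interiorProd v θ := rfl

theorem interiorProd_smul (v : VectorField E M) (c : ℝ) (η : DiffForm E M (k + 1)) :
    interiorProd v (c • η) = c • interiorProd v η := rfl

theorem interiorProd_zero (v : VectorField E M) :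
    interiorProd v (0 : DiffForm E M (k + 1)) = 0 := rfl

theorem interiorProd_swap (v w : VectorField E M) (η : DiffForm E M (k + 2)) :
    interiorProd v (interiorProd w η) = -interiorProd w (interiorProd v η) :=
  funext fun x ↦ ContinuousAlternatingMap.ext fun u ↦
    alternatingMap_vecCons_swap (η x).toAlternatingMap (w x) (v x) u

theorem extD_neg (η : DiffForm E M k) : extD (-η) = -extD η := by
  rw [← neg_one_smul ℝ η, extD_smul]
  module

theorem extD_interiorProd (v : VectorField E M) (η : DiffForm E M (k + 1)) :
    extD (interiorProd v η) = lieDerivative v η - interiorProd v (extD η) :=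
  (add_sub_cancel_right _ _).symm

theorem lieDerivative_add (v : VectorField E M) {η θ : DiffForm E M k}
    (hη : η ∈ smoothForms E M k) (hθ : θ ∈ smoothForms E M k) :
    lieDerivative v (η + θ) = lieDerivative v η + lieDerivative v θ := by
  cases k with
  | zero => rw [lieDerivative, extD_add hη hθ]; rfl
  | succ k =>
    rw [lieDerivative, lieDerivative, lieDerivative, interiorProd_add, extD_add hη hθ,
      extD_add (interiorProd_mem_smoothForms v hη) (interiorProd_mem_smoothForms v hθ),
      interiorProd_add]
    exact add_add_add_comm ..

theorem lieDerivative_smul (v : VectorField E M) (c : ℝ) (η : DiffForm E M k) :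
    lieDerivative v (c • η) = c • lieDerivative v η := by
  cases k with
  | zero => rw [lieDerivative, extD_smul]; rfl
  | succ k =>
    rw [lieDerivative, lieDerivative, interiorProd_smul, extD_smul, extD_smul, interiorProd_smul]
    exact (smul_add ..).symm

theorem lieDerivative_extD (v : VectorField E M) {η : DiffForm E M k}
    (hη : η ∈ smoothForms E M k) : lieDerivative v (extD η) = extD (lieDerivative v η) := by
  have hdη := extD_mem_smoothForms hη
  rw [lieDerivative, extD_extD hη, interiorProd_zero, add_zero]
  cases k with
  | zero => rfl
  | succ k =>
    have hι := interiorProd_mem_smoothForms v hη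
    rw [lieDerivative, extD_add (extD_mem_smoothForms hι) (interiorProd_mem_smoothForms v hdη),
      extD_extD hι, zero_add]

theorem isGloballyConserved_of_isExactForm_interiorProd_extD {v : VectorField E M}
    {α : DiffForm E M k} (hα : α ∈ smoothForms E M k)
    (h : IsExactForm (interiorProd v (extD α))) : IsGloballyConserved v α := by
  cases k with
  | zero => exact h
  | succ k =>
    obtain ⟨β, hβ, hιd⟩ := h
    have hι := interiorProd_mem_smoothForms v hα
    refine ⟨interiorProd v α + β, add_mem hι hβ, ?_⟩
    rw [lieDerivative, hιd, extD_add hι hβ]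

end CartanCalculus

section Contraction

section Pointwise

variable {V : Type*} [NormedAddCommGroup V] [NormedSpace ℝ V] {k l : ℕ}

theorem contract_ιMulti (α : V [⋀^Fin (l + k)]→L[ℝ] ℝ) (u : Fin k → V) :
    contract α (exteriorPower.ιMulti ℝ k u) = iterContract α u :=
  exteriorPower.alternatingMapLinearEquiv_apply_ιMulti (contractAlt α) u

theorem contract_of_degree_zero (α : V [⋀^Fin l]→L[ℝ] ℝ) (P : ⋀[ℝ]^0 V) :
    contract α P = exteriorPower.zeroEquiv ℝ V P • α := by
  suffices h : contract α =
      (exteriorPower.zeroEquiv ℝ V).toLinearMap.smulRight α from DFunLike.congr_fun h P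
  refine exteriorPower.linearMap_ext (AlternatingMap.ext fun u ↦ ?_)
  simp only [LinearMap.compAlternatingMap_apply, contract_ιMulti, LinearMap.smulRight_apply,
    LinearEquiv.coe_coe, exteriorPower.zeroEquiv_ιMulti, one_smul, iterContract]

theorem contract_wedge (α : V [⋀^Fin (l + (k + 1))]→L[ℝ] ℝ) (a : V) (P : ⋀[ℝ]^k V) :
    contract α (wedge a P) =
      contract (l := l) (ContinuousAlternatingMap.curryLeft (n := l + k) α a) P := by
  suffices h : contract α ∘ₗ wedge a =
      contract (l := l) (ContinuousAlternatingMap.curryLeft (n := l + k) α a) from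
    DFunLike.congr_fun h P
  refine exteriorPower.linearMap_ext (AlternatingMap.ext fun u ↦ ?_)
  simp only [LinearMap.compAlternatingMap_apply, LinearMap.comp_apply, wedge_ιMulti,
    contract_ιMulti]
  rfl

theorem contract_add (α β : V [⋀^Fin (l + k)]→L[ℝ] ℝ) (P : ⋀[ℝ]^k V) :
    contract (α + β) P = contract α P + contract β P := by
  suffices h : contract (α + β) = contract α + contract β from DFunLike.congr_fun h P
  refine exteriorPower.linearMap_ext (AlternatingMap.ext fun u ↦ ?_)
  ext w
  simp only [LinearMap.compAlternatingMap_apply, LinearMap.add_apply, contract_ιMulti,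
    ContinuousAlternatingMap.add_apply, iterContract_apply]

theorem contract_smul (c : ℝ) (α : V [⋀^Fin (l + k)]→L[ℝ] ℝ) (P : ⋀[ℝ]^k V) :
    contract (c • α) P = c • contract α P := by
  suffices h : contract (c • α) = c • contract α from DFunLike.congr_fun h P
  refine exteriorPower.linearMap_ext (AlternatingMap.ext fun u ↦ ?_)
  ext w
  simp only [LinearMap.compAlternatingMap_apply, LinearMap.smul_apply, contract_ιMulti,
    ContinuousAlternatingMap.smul_apply, iterContract_apply]

end Pointwise

variable {E : Type*} [NormedAddCommGroup E] [NormedSpace ℝ E]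
  {M : Type*} [TopologicalSpace M] [ChartedSpace E M] [IsManifold 𝓘(ℝ, E) ∞ M]
  {𝔤 : Type*} [LieRing 𝔤] [LieAlgebra ℝ 𝔤] {k l n : ℕ}

namespace InfinitesimalAction

variable (v : InfinitesimalAction E M 𝔤)

/-- The contraction `ι(v_p) η` as a bilinear map in `p ∈ Λ^k 𝔤` and `η`. The degree of `η`
is any `n` equal to `l + k` rather than `l + k` itself, so that no degree casts are needed. -/
def contractionₗ (h : n = l + k) : ⋀[ℝ]^k 𝔤 →ₗ[ℝ] DiffForm E M n →ₗ[ℝ] DiffForm E M l :=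
  LinearMap.mk₂ ℝ (fun p η ↦ v.contraction p (η.cast h))
    (fun p q η ↦ funext fun x ↦ by simp only [contraction, map_add]; rfl)
    (fun c p η ↦ funext fun x ↦ by simp only [contraction, map_smul]; rfl)
    (fun p η θ ↦ by subst h; exact funext fun x ↦ contract_add ..)
    (fun c p η ↦ by subst h; exact funext fun x ↦ contract_smul ..)

theorem contractionₗ_of_degree_zero (p : ⋀[ℝ]^0 𝔤) (η : DiffForm E M n) :
    v.contractionₗ rfl p η = exteriorPower.zeroEquiv ℝ 𝔤 p • η :=
  funext fun x ↦ (contract_of_degree_zero (V := E) (η x) _).trans <| congrArg (· • η x) <|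
    DFunLike.congr_fun (exteriorPower.zeroEquiv_naturality (v.fieldAt x)) p

theorem contractionₗ_wedge (h : n + 1 = l + (k + 1)) (x : 𝔤) (p : ⋀[ℝ]^k 𝔤)
    (η : DiffForm E M (n + 1)) :
    v.contractionₗ h (wedge x p) η =
      v.contractionₗ (Nat.succ.inj h) p (interiorProd (v.field x) η) := by
  obtain rfl : n = l + k := Nat.succ.inj h
  exact funext fun y ↦ (congrArg (contract (V := E) (l := l) (k := k + 1) (η y))
    (map_wedge (v.fieldAt y) x p)).trans
    (contract_wedge (V := E) (l := l) (k := k) (η y) _ _)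

theorem contractionₗ_mem_smoothForms (h : n = l + k) (p : ⋀[ℝ]^k 𝔤) {η : DiffForm E M n}
    (hη : η ∈ smoothForms E M n) : v.contractionₗ h p η ∈ smoothForms E M l := by
  induction k generalizing n with
  | zero =>
    obtain rfl : n = l := h
    rw [contractionₗ_of_degree_zero]
    exact Submodule.smul_mem _ _ hη
  | succ k ih =>
    obtain ⟨n, rfl⟩ : ∃ n', n = n' + 1 := ⟨l + k, h⟩
    induction p using wedge_induction with
    | wedge x p =>
      rw [contractionₗ_wedge]
      exact ih _ _ (interiorProd_mem_smoothForms _ hη)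
    | add p q hp hq =>
      rw [map_add]
      exact add_mem hp hq

theorem contractionₗ_interiorProd (h : n + 1 = l + 1 + k) (w : VectorField E M)
    (p : ⋀[ℝ]^k 𝔤) (η : DiffForm E M (n + 1)) :
    v.contractionₗ (show n = l + k by omega) p (interiorProd w η) =
      (-1 : ℝ) ^ k • interiorProd w (v.contractionₗ h p η) := by
  induction k generalizing n with
  | zero =>
    obtain rfl : n = l := Nat.succ.inj h
    rw [contractionₗ_of_degree_zero, contractionₗ_of_degree_zero, pow_zero, one_smul]
    rfl
  | succ k ih =>
    obtain ⟨n, rfl⟩ : ∃ n', n = n' + 1 := ⟨l + k, by omega⟩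
    induction p using wedge_induction with
    | wedge x p =>
      rw [contractionₗ_wedge, contractionₗ_wedge, interiorProd_swap, map_neg,
        ih (show n + 1 = l + 1 + k by omega), pow_succ]
      module
    | add p q hp hq =>
      simp only [map_add, LinearMap.add_apply, hp, hq, interiorProd_add, smul_add]

theorem contractionₗ_wedge_eq_smul_interiorProd (h : n = l + (k + 1)) (x : 𝔤) (p : ⋀[ℝ]^k 𝔤)
    (η : DiffForm E M n) :
    v.contractionₗ h (wedge x p) η = (-1 : ℝ) ^ k •
      interiorProd (v.field x) (v.contractionₗ (show n = l + 1 + k by omega) p η) := by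
  obtain ⟨n, rfl⟩ : ∃ n', n = n' + 1 := ⟨l + k, h⟩
  rw [contractionₗ_wedge, contractionₗ_interiorProd]

theorem lieDerivative_contractionₗ (h : n = l + k) (x : 𝔤) (p : ⋀[ℝ]^k 𝔤) {η : DiffForm E M n}
    (hη : η ∈ smoothForms E M n) :
    lieDerivative (v.field x) (v.contractionₗ h p η) =
      v.contractionₗ h (adWedge x k p) η +
        v.contractionₗ h p (lieDerivative (v.field x) η) := by
  induction k generalizing n with
  | zero =>
    obtain rfl : n = l := h
    rw [adWedge, LinearMap.zero_apply, map_zero, LinearMap.zero_apply, zero_add,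
      contractionₗ_of_degree_zero, contractionₗ_of_degree_zero, lieDerivative_smul]
  | succ k ih =>
    obtain ⟨n, rfl⟩ : ∃ n', n = n' + 1 := ⟨l + k, h⟩
    induction p using wedge_induction with
    | wedge y p =>
      rw [contractionₗ_wedge, ih _ _ (interiorProd_mem_smoothForms _ hη),
        lieDerivative_interiorProd _ _ _ (v.field_lie x y) hη, adWedge_wedge, map_add, map_add,
        LinearMap.add_apply, contractionₗ_wedge, contractionₗ_wedge, contractionₗ_wedge]
      abel
    | add p q hp hq =>
      have hsmooth (p) := v.contractionₗ_mem_smoothForms h p hη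
      simp only [map_add, LinearMap.add_apply, lieDerivative_add _ (hsmooth p) (hsmooth q), hp, hq]
      abel

variable {v} {η : DiffForm E M n}

theorem IsMultisymplectic.lieDerivative_contractionₗ (hv : v.IsMultisymplectic η)
    (hη : η ∈ smoothForms E M n) (h : n = l + k) (x : 𝔤) (p : ⋀[ℝ]^k 𝔤) :
    lieDerivative (v.field x) (v.contractionₗ h p η) = v.contractionₗ h (adWedge x k p) η := by
  rw [v.lieDerivative_contractionₗ h x p hη, hv x, map_zero, add_zero]

theorem contractionₗ_lieBoundary_wedge (hη : η ∈ smoothForms E M n) (hv : v.IsMultisymplectic η)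
    (h : n = l + (k + 1)) (x : 𝔤) (p : ⋀[ℝ]^(k + 1) 𝔤) :
    v.contractionₗ h (lieBoundary 𝔤 (k + 1) (wedge x p)) η =
      -lieDerivative (v.field x) (v.contractionₗ h p η) - (-1 : ℝ) ^ k • interiorProd (v.field x)
        (v.contractionₗ (show n = l + 1 + k by omega) (lieBoundary 𝔤 k p) η) := by
  rw [lieBoundary_wedge, hv.lieDerivative_contractionₗ hη, map_sub, map_neg, LinearMap.sub_apply,
    LinearMap.neg_apply, contractionₗ_wedge_eq_smul_interiorProd]

theorem extD_contractionₗ (hη : η ∈ smoothForms E M n) (hdη : IsClosedForm η)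
    (hv : v.IsMultisymplectic η) (h : n = l + (k + 1)) (q : ⋀[ℝ]^(k + 1) 𝔤) :
    extD (v.contractionₗ h q η) = (-1 : ℝ) ^ (k + 1) •
      v.contractionₗ (show n = l + 1 + k by omega) (lieBoundary 𝔤 k q) η := by
  induction k generalizing l with
  | zero =>
    obtain rfl : n = l + 1 := h
    induction q using wedge_induction with
    | wedge x p =>
      rw [contractionₗ_wedge_eq_smul_interiorProd, contractionₗ_of_degree_zero, interiorProd_smul,
        extD_smul, extD_smul, extD_interiorProd, hv x, hdη, interiorProd_zero, sub_zero, smul_zero,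
        smul_zero, lieBoundary, LinearMap.zero_apply, map_zero, LinearMap.zero_apply, smul_zero]
    | add p q hp hq =>
      have hsmooth (p) := v.contractionₗ_mem_smoothForms rfl p hη
      simp only [map_add, LinearMap.add_apply, extD_add (hsmooth p) (hsmooth q), hp, hq, smul_add]
  | succ k ih =>
    induction q using wedge_induction with
    | wedge x p =>
      rw [contractionₗ_wedge_eq_smul_interiorProd, extD_smul, extD_interiorProd, ih,
        contractionₗ_lieBoundary_wedge hη hv, interiorProd_smul, pow_succ, pow_succ]
      module
    | add p q hp hq =>
      have hsmooth (p) := v.contractionₗ_mem_smoothForms h p hη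
      simp only [map_add, LinearMap.add_apply, extD_add (hsmooth p) (hsmooth q), hp, hq, smul_add]

theorem contractionₗ_lieBoundary_eq_zero (hη : η ∈ smoothForms E M n) (hdη : IsClosedForm η)
    (hv : v.IsMultisymplectic η) (h : n = 0 + k) (q : ⋀[ℝ]^(k + 1) 𝔤) :
    v.contractionₗ h (lieBoundary 𝔤 k q) η = 0 := by
  cases k with
  | zero => rw [lieBoundary, LinearMap.zero_apply, map_zero, LinearMap.zero_apply]
  | succ k =>
    induction q using wedge_induction with
    | wedge x p =>
      rw [contractionₗ_lieBoundary_wedge hη hv, lieDerivative, extD_contractionₗ hη hdη hv,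
        interiorProd_smul, pow_succ]
      module
    | add p q hp hq => rw [map_add, map_add, LinearMap.add_apply, hp, hq, add_zero]

theorem isExactForm_contractionₗ_lieBoundary (hη : η ∈ smoothForms E M n) (hdη : IsClosedForm η)
    (hv : v.IsMultisymplectic η) (h : n = l + k) (q : ⋀[ℝ]^(k + 1) 𝔤) :
    IsExactForm (v.contractionₗ h (lieBoundary 𝔤 k q) η) := by
  cases l with
  | zero => exact contractionₗ_lieBoundary_eq_zero hη hdη hv h q
  | succ l =>
    have hsmooth := v.contractionₗ_mem_smoothForms (show n = l + (k + 1) by omega) q hη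
    refine ⟨(-1 : ℝ) ^ (k + 1) • v.contractionₗ _ q η, Submodule.smul_mem _ _ hsmooth, ?_⟩
    rw [extD_smul, extD_contractionₗ hη hdη hv, smul_smul, ← mul_pow, neg_one_mul, neg_neg,
      one_pow, one_smul]

end InfinitesimalAction

end Contraction

section Conservation

variable {E : Type*} [NormedAddCommGroup E] [NormedSpace ℝ E]
  {M : Type*} [TopologicalSpace M] [ChartedSpace E M] [IsManifold 𝓘(ℝ, E) ∞ M]
  {𝔤 : Type*} [LieRing 𝔤] [LieAlgebra ℝ 𝔤] {k l m : ℕ}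
  {η : DiffForm E M (m + 2)} {H : DiffForm E M m} {v : InfinitesimalAction E M 𝔤}

theorem InfinitesimalAction.LocallyPreserves.isMultisymplectic_extD (hpres : v.LocallyPreserves H)
    (hH : H ∈ smoothForms E M m) : v.IsMultisymplectic (extD H) := fun x ↦
  (lieDerivative_extD (v.field x) hH).trans (hpres x)

theorem IsHamiltonianVectorField.interiorProd_contractionₗ {w : VectorField E M}
    (hw : IsHamiltonianVectorField η H w) (h : m + 2 = l + 1 + k) (p : ⋀[ℝ]^k 𝔤) :
    interiorProd w (v.contractionₗ h p η) =
      -(-1 : ℝ) ^ k • v.contractionₗ (show m + 1 = l + k by omega) p (extD H) := by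
  have hdH : extD H = -interiorProd w η := hw
  rw [hdH, map_neg, v.contractionₗ_interiorProd h, smul_neg, smul_smul, neg_mul, ← mul_pow,
    neg_one_mul, neg_neg, one_pow]
  module

theorem LInftyMorphism.extD_component_lieBoundary (f : LInftyMorphism η v)
    (hη : η ∈ smoothForms E M (m + 2)) (hdη : IsClosedForm η) (hv : v.IsMultisymplectic η)
    (hkl : k + l = m + 1) (q : ⋀[ℝ]^(k + 1) 𝔤) :
    extD (f.component k l hkl (lieBoundary 𝔤 k q) : DiffForm E M l) =
      ((-1) ^ k * sgn (k + 1)) •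
        v.contractionₗ (show m + 2 = l + 1 + k by omega) (lieBoundary 𝔤 k q) η := by
  have hsmooth := v.contractionₗ_mem_smoothForms (show m + 2 = l + (k + 1) by omega) q hη
  have hd : extD (-(f.component k l hkl (lieBoundary 𝔤 k q) : DiffForm E M l)) =
      sgn (k + 1) • extD (v.contractionₗ (show m + 2 = l + (k + 1) by omega) q η) := by
    cases l with
    | zero =>
      obtain rfl : k = m + 1 := hkl
      rw [← extD_smul]
      exact congrArg extD (f.main_top q)
    | succ l =>
      have hf : (f.component (k + 1) l (by omega) q : DiffForm E M l) ∈ smoothForms E M l :=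
        Subtype.property _
      refine (congrArg extD (f.main k l (by omega) q)).trans ?_
      refine (extD_add (extD_mem_smoothForms hf) (Submodule.smul_mem _ _ hsmooth)).trans ?_
      rw [extD_extD hf, zero_add, extD_smul]
  rw [extD_neg, InfinitesimalAction.extD_contractionₗ hη hdη hv] at hd
  rw [neg_eq_iff_eq_neg.mp hd, pow_succ]
  module

end Conservation

end Multisymplectic

end

open Multisymplectic in
theorem mainTheorem3_general
    {E : Type*} [NormedAddCommGroup E] [NormedSpace ℝ E]
    {M : Type*} [TopologicalSpace M] [ChartedSpace E M] [IsManifold 𝓘(ℝ, E) ∞ M]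
    {𝔤 : Type*} [LieRing 𝔤] [LieAlgebra ℝ 𝔤] {m : ℕ}
    (η : smoothForms E M (m + 2)) (hη : IsClosedForm (η : DiffForm E M (m + 2)))
    (v : InfinitesimalAction E M 𝔤) (hv : v.IsMultisymplectic (η : DiffForm E M (m + 2)))
    (H : smoothForms E M m) (hpres : v.LocallyPreserves (H : DiffForm E M m))
    (f : LInftyMorphism (η : DiffForm E M (m + 2)) v) {k l : ℕ} (hkl : k + l = m + 1)
    (p : ⋀[ℝ]^k 𝔤) (hp : p ∈ boundaries 𝔤 k) (vH : VectorField E M)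
    (hvH : IsHamiltonianVectorField (η : DiffForm E M (m + 2)) (H : DiffForm E M m) vH) :
    IsGloballyConserved vH (f.component k l hkl p : DiffForm E M l) := by
  obtain ⟨q, rfl⟩ := hp
  refine isGloballyConserved_of_isExactForm_interiorProd_extD (f.component k l hkl _).2 ?_
  rw [f.extD_component_lieBoundary η.2 hη hv, interiorProd_smul, hvH.interiorProd_contractionₗ]
  have hexact := InfinitesimalAction.isExactForm_contractionₗ_lieBoundary
    (extD_mem_smoothForms H.2) (extD_extD H.2) (hpres.isMultisymplectic_extD H.2)
    (show m + 1 = l + k by omega) q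
  exact (hexact.smul _).smul _

/-- Here `η` is the closed `(n+1)`-form of a pre-`n`-plectic manifold, with `n = m + 1 ≥ 1`, and
`f.component k l _ : Λ^k 𝔤 → Ω^l(M)`, `l = n - k`, is the `k`-th component of the co-momentum map,
for `1 ≤ k ≤ n`. -/
theorem mainTheorem3
    {E : Type*} [NormedAddCommGroup E] [NormedSpace ℝ E] [FiniteDimensional ℝ E]
    {M : Type*} [TopologicalSpace M] [ChartedSpace E M] [IsManifold 𝓘(ℝ, E) ∞ M]
    {𝔤 : Type*} [LieRing 𝔤] [LieAlgebra ℝ 𝔤] {m : ℕ}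
    (η : Multisymplectic.smoothForms E M (m + 2))
    (hη : Multisymplectic.IsClosedForm (η : Multisymplectic.DiffForm E M (m + 2)))
    (v : Multisymplectic.InfinitesimalAction E M 𝔤)
    (hv : v.IsMultisymplectic (η : Multisymplectic.DiffForm E M (m + 2)))
    (H : Multisymplectic.smoothForms E M m)
    (hH : Multisymplectic.IsHamiltonianForm
      (η : Multisymplectic.DiffForm E M (m + 2)) (H : Multisymplectic.DiffForm E M m))
    (hpres : v.LocallyPreserves (H : Multisymplectic.DiffForm E M m))
    (f : Multisymplectic.CoMomentumMap (η : Multisymplectic.DiffForm E M (m + 2)) v)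
    {k l : ℕ} (hk : 1 ≤ k) (hkl : k + l = m + 1)
    (p : ⋀[ℝ]^k 𝔤) (hp : p ∈ Multisymplectic.boundaries 𝔤 k)
    (vH : Multisymplectic.VectorField E M)
    (hvH : Multisymplectic.IsHamiltonianVectorField
      (η : Multisymplectic.DiffForm E M (m + 2)) (H : Multisymplectic.DiffForm E M m) vH) :
    Multisymplectic.IsGloballyConserved vH
      (f.component k l hkl p : Multisymplectic.DiffForm E M l) :=
  mainTheorem3_general η hη v hv H hpres f.toLInftyMorphism hkl p hp vH hvH
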